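/- Let $X$ be a measurable space and let $\mathcal H$ be a separable complex Hilbert space, with algebra of bounded operators $\mathcal B(\mathcal H)$. A \emph{POVM} on $X$ with values in $\mathcal B(\mathcal H)$ assigns to each measurable set $A$ a positive operator $\mu(A)\in\mathcal B(\mathcal H)$ such that $A\mapsto\langle h,\mu(A)k\rangle$ is a complex measure for all $h,k\in\mathcal H$. It is \emph{normalized} if $\mu(X)=I_{\mathcal H}$, and \emph{spectral} if it is normalized and every $\mu(A)$ is an orthogonal projection. A measurable set $A$ is an \emph{atom} for $\mu$ if $\mu(A)\neq 0$ and every measurable $B\subseteq A$ satisfies $\mu(B)=0$ or $\mu(B)=\mu(A)$; $\mu$ is \emph{atomic} if every measurable $A$ with $\mu(A)\ne 0$ contains an atom, and \emph{non-atomic} if it has no atom. Two POVMs $\mu_1,\mu_2$ on $X$ (possibly acting on different spaces) are \emph{mutually singular} if there are disjoint measurable sets $X_1,X_2$ with $\mu_i(A)=\mu_i(A\cap X_i)$ for all measurable $A$ and $i=1,2$. A normalized POVM $\mu$ is \emph{$C^*$-extreme} if, whenever $\mu(\cdot)=\sum_{i=1}^n T_i^*\nu_i(\cdot)T_i$ with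 normalized POVMs $\nu_i$ with values in $\mathcal B(\mathcal H)$ and invertible $T_i\in\mathcal B(\mathcal H)$ such that $\sum_{i=1}^n T_i^*T_i=I_{\mathcal H}$, there are unitaries $U_i\in\mathcal B(\mathcal H)$ with $\nu_i(\cdot)=U_i^*\mu(\cdot)U_i$ for $1\le i\le n$. \textbf{Theorem.} Let $\mu$ be a $C^*$-extreme normalized POVM on $X$ with values in $\mathcal B(\mathcal H)$. Then there are an orthogonal decomposition $\mathcal H=\mathcal K_1\oplus\mathcal K_2$ into closed subspaces (either of which may be $\{0\}$) and normalized POVMs $\mu_i$ on $X$ with values in $\mathcal B(\mathcal K_i)$, $i=1,2$, such that $\mu=\mu_1\oplus\mu_2$, that is, $\mu(A)(x+y)=\mu_1(A)x+\mu_2(A)y$ for all measurable $A$, $x\in\mathcal K_1$, $y\in\mathcal K_2$, and such that $\mu_1$ is atomic, $\mu_2$ is non-atomic, and $\mu_1,\mu_2$ are mutually singular. Such a decomposition is unique: the subspaces $\mathcal K_1,\mathcal K_2$ and the POVMs $\mu_1,\mu_2$ are determined by $\mu$. Moreover, $\mu_1$ and $\mu_2$ are $C^*$-extreme among the normalized POVMs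 on $X$ with values in $\mathcal B(\mathcal K_1)$ and $\mathcal B(\mathcal K_2)$ respectively, and $\mu_1$ is spectral. -/

import Mathlib

/-- A positive operator valued measure on the measurable space `X` with values in the bounded
operators on the complex inner product space `H`. As for Mathlib's vector measures, the value on
non-measurable sets is fixed to be `0`, so that two such measures are equal exactly when they agree
on all measurable sets. -/
@[ext]
structure POVM (X : Type*) [MeasurableSpace X] (H : Type*) [NormedAddCommGroup H]
    [InnerProductSpace ℂ H] where
  toFun : Set X → (H →L[ℂ] H)
  isPositive' : ∀ A, MeasurableSet A → (toFun A).IsPositive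
  isComplexMeasure' : ∀ h k : H, ∃ m : MeasureTheory.ComplexMeasure X,
    ∀ A, MeasurableSet A → m A = inner ℂ h (toFun A k)
  not_measurable' : ∀ A, ¬ MeasurableSet A → toFun A = 0

namespace POVM

section Basic

variable {X : Type*} [MeasurableSpace X]
variable {H : Type*} [NormedAddCommGroup H] [InnerProductSpace ℂ H]

instance : CoeFun (POVM X H) (fun _ => Set X → (H →L[ℂ] H)) := ⟨POVM.toFun⟩

/-- `μ(X)` is the identity operator. -/
def IsNormalized (μ : POVM X H) : Prop := μ Set.univ = 1

/-- `A` is an atom for `μ`. -/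
def IsAtom (μ : POVM X H) (A : Set X) : Prop :=
  MeasurableSet A ∧ μ A ≠ 0 ∧ ∀ B, MeasurableSet B → B ⊆ A → μ B = 0 ∨ μ B = μ A

/-- Every measurable set of non-zero measure contains an atom. -/
def IsAtomic (μ : POVM X H) : Prop :=
  ∀ A, MeasurableSet A → μ A ≠ 0 → ∃ B, B ⊆ A ∧ μ.IsAtom B

/-- There are no atoms. -/
def IsNonAtomic (μ : POVM X H) : Prop := ∀ A, ¬ μ.IsAtom A

/-- Mutual singularity of two POVMs, possibly acting on different spaces: they are concentrated on
disjoint measurable sets. -/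
def MutuallySingular {H₁ H₂ : Type*} [NormedAddCommGroup H₁] [InnerProductSpace ℂ H₁]
    [NormedAddCommGroup H₂] [InnerProductSpace ℂ H₂] (μ₁ : POVM X H₁) (μ₂ : POVM X H₂) : Prop :=
  ∃ X₁ X₂ : Set X, MeasurableSet X₁ ∧ MeasurableSet X₂ ∧ Disjoint X₁ X₂ ∧
    (∀ A, MeasurableSet A → μ₁ A = μ₁ (A ∩ X₁)) ∧
    (∀ A, MeasurableSet A → μ₂ A = μ₂ (A ∩ X₂))

end Basic

section Hilbert

variable {X : Type*} [MeasurableSpace X]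
variable {H : Type*} [NormedAddCommGroup H] [InnerProductSpace ℂ H] [CompleteSpace H]

/-- A spectral measure: normalized, and all its values are (orthogonal) projections. -/
def IsSpectral (μ : POVM X H) : Prop :=
  μ.IsNormalized ∧ ∀ A, MeasurableSet A → IsStarProjection (μ A)

/-- `μ = ∑ Tᵢ* νᵢ(·) Tᵢ` is a proper `C*`-convex combination of the normalized POVMs `νᵢ`: the
coefficients `Tᵢ` are invertible and `∑ Tᵢ* Tᵢ` is the identity. -/
def IsProperCStarCombination (μ : POVM X H) {n : ℕ} (ν : Fin n → POVM X H)
    (T : Fin n → (H →L[ℂ] H)) : Prop :=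
  (∀ i, (ν i).IsNormalized) ∧ (∀ i, IsUnit (T i)) ∧ ∑ i, star (T i) * T i = 1 ∧
    ∀ A, MeasurableSet A → μ A = ∑ i, star (T i) * ν i A * T i

/-- `ν = U* μ(·) U` for some unitary `U`. -/
def UnitarilyEquivalent (ν μ : POVM X H) : Prop :=
  ∃ U ∈ unitary (H →L[ℂ] H), ∀ A, MeasurableSet A → ν A = star U * μ A * U

/-- `μ` is a `C*`-extreme point of the set of normalized POVMs on `X` with values in the bounded
operators on `H`. -/
def IsCStarExtreme (μ : POVM X H) : Prop :=
  μ.IsNormalized ∧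
    ∀ (n : ℕ) (ν : Fin n → POVM X H) (T : Fin n → (H →L[ℂ] H)),
      μ.IsProperCStarCombination ν T → ∀ i, (ν i).UnitarilyEquivalent μ

instance (K : ClosedSubmodule ℂ H) : CompleteSpace K.toSubmodule :=
  inferInstanceAs (CompleteSpace K)

/-- A decomposition `μ = μ₁ ⊕ μ₂` along an orthogonal decomposition `H = K₁ ⊕ K₂` into closed
subspaces (either of which may be zero). -/
structure DirectSumDecomposition (μ : POVM X H) where
  K₁ : ClosedSubmodule ℂ H
  K₂ : ClosedSubmodule ℂ H
  orthogonal_eq : K₂ = K₁ᗮ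
  μ₁ : POVM X K₁.toSubmodule
  μ₂ : POVM X K₂.toSubmodule
  eq_directSum : ∀ A, MeasurableSet A → ∀ (x : K₁.toSubmodule) (y : K₂.toSubmodule),
    μ A ((x : H) + (y : H)) = (μ₁ A x : H) + (μ₂ A y : H)

/-- The first summand is an atomic normalized POVM, the second one is a non-atomic normalized POVM,
and they are mutually singular. -/
def DirectSumDecomposition.IsAtomicNonAtomic {μ : POVM X H} (d : μ.DirectSumDecomposition) :
    Prop :=
  d.μ₁.IsNormalized ∧ d.μ₁.IsAtomic ∧ d.μ₂.IsNormalized ∧ d.μ₂.IsNonAtomic ∧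
    MutuallySingular d.μ₁ d.μ₂

end Hilbert

end POVM

/-! The heart of the matter is that a `C*`-extreme POVM takes a projection as its value at each
atom. Let `A` be an atom and `T = μ A`, so that inside `A` the POVM is a scalar measure times `T`.
For a continuous weight `w` near `1`, put `W₀ = w` and `W₁ = 2 - w`. With coefficients `√(Wᵢ(T) /
2)`, `μ` is a proper combination of POVMs whose values at `A` are `1 - (1 - T) / Wᵢ(T)`
(`IsCStarExtreme.exists_unitary_cfc`). Extremality makes these values unitarily equivalent to `T`.
If the spectrum of `T` met `(0, 1)` at `x₀`, then `w` could be chosen to make `1 - (1 - x) / w x`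
constant near `x₀`, equal to any prescribed `c` near `x₀`. That `c` would be an eigenvalue of the
perturbed value, hence of `T`. A positive operator on a separable space cannot have a whole interval
of eigenvalues, so the spectrum of `T` lies in `{0, 1}`.

Disjoint atoms now carry orthogonal projections, so a maximal disjoint family of atoms is countable.
Its union `E` has a projection as measure, which commutes with all of `μ` and splits the space; `μ₁`
lives on `E` and `μ₂` on the complement. Uniqueness holds because two candidate sets `E` differ by a
`μ`-null set (`null_diff`). Extremality passes to a summand by padding a combination with scalar
copies of the other one (`isCStarExtreme_left`). -/

open scoped Function

/-! ### Preliminaries on orthonormal families and projections. -/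

/-- An orthonormal family in a separable space is countable. -/
theorem Orthonormal.countable_of_separableSpace {H : Type*} [NormedAddCommGroup H]
    [InnerProductSpace ℂ H] [TopologicalSpace.SeparableSpace H] {ι : Type*} {v : ι → H}
    (hv : Orthonormal ℂ v) : Countable ι := by
  refine Pairwise.countable_of_isOpen_disjoint (s := fun i ↦ Metric.ball (v i) (1 / 2)) ?_
    (fun _ ↦ Metric.isOpen_ball) (fun i ↦ ⟨v i, Metric.mem_ball_self (by norm_num)⟩)
  intro i j hij
  -- Distinct members lie at distance `√2`, which exceeds `1 / 2 + 1 / 2`.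
  refine Metric.ball_disjoint_ball ?_
  have h : ‖v i - v j‖ * ‖v i - v j‖ = 2 := by
    have h0 : inner ℂ (v i) (v j) = 0 := hv.2 hij
    rw [norm_sub_mul_self (𝕜 := ℂ), h0, hv.1 i, hv.1 j]
    norm_num
  rw [dist_eq_norm]
  nlinarith [norm_nonneg (v i - v j)]

/-- Passing to complements gives `0 ≤ 1 - Q ≤ 1 - P`, and a positive operator below a projection is
absorbed by it. -/
theorem IsStarProjection.mul_eq_of_le_of_le_one {H : Type*} [NormedAddCommGroup H]
    [InnerProductSpace ℂ H] [CompleteSpace H] {P Q : H →L[ℂ] H} (hP : IsStarProjection P)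
    (hPQ : P ≤ Q) (hQ : Q ≤ 1) : Q * P = P := by
  have h := (hP.one_sub.mul_right_and_mul_left_of_nonneg_of_le (a := 1 - Q)
    (sub_nonneg.2 hQ) (sub_le_sub_left hPQ 1)).1
  rw [sub_mul, mul_sub, mul_sub] at h
  simp only [mul_one, one_mul] at h
  have h2 : Q * P - P = (1 - P - (Q - Q * P)) - (1 - Q) := by abel
  rw [h, sub_self] at h2
  exact sub_eq_zero.1 h2

/-! ### Elementary properties of POVMs and their atoms. -/

namespace POVM

section Basic

variable {X : Type*} [MeasurableSpace X]
variable {H : Type*} [NormedAddCommGroup H] [InnerProductSpace ℂ H]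
variable (μ : POVM X H) {A B : Set X}

theorem nonneg (hA : MeasurableSet A) : 0 ≤ μ A :=
  (ContinuousLinearMap.nonneg_iff_isPositive _).2 (μ.isPositive' A hA)

theorem empty : μ ∅ = 0 := by
  ext k
  refine ext_inner_left ℂ fun h ↦ ?_
  obtain ⟨m, hm⟩ := μ.isComplexMeasure' h k
  rw [← hm _ .empty]
  simp

theorem union (hA : MeasurableSet A) (hB : MeasurableSet B) (h : Disjoint A B) :
    μ (A ∪ B) = μ A + μ B := by
  ext k
  refine ext_inner_left ℂ fun x ↦ ?_
  obtain ⟨m, hm⟩ := μ.isComplexMeasure' x k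
  rw [← hm _ (hA.union hB), add_apply, inner_add_right, ← hm _ hA, ← hm _ hB]
  exact m.of_union h hA hB

theorem inter_add_diff (hA : MeasurableSet A) (hB : MeasurableSet B) :
    μ (A ∩ B) + μ (A \ B) = μ A := by
  rw [← μ.union (hA.inter hB) (hA.diff hB) Set.disjoint_sdiff_inter.symm, Set.inter_union_sdiff]

theorem mono [CompleteSpace H] (hA : MeasurableSet A) (hB : MeasurableSet B) (h : A ⊆ B) :
    μ A ≤ μ B := by
  rw [← μ.inter_add_diff hB hA, Set.inter_eq_self_of_subset_right h]
  exact le_add_of_nonneg_right (μ.nonneg (hB.diff hA))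

theorem null_of_subset [CompleteSpace H] (hA : MeasurableSet A) (hB : MeasurableSet B) (h : A ⊆ B)
    (h0 : μ B = 0) : μ A = 0 :=
  le_antisymm (h0 ▸ μ.mono hA hB h) (μ.nonneg hA)

theorem hasSum_inner {ι : Type*} [Countable ι] {f : ι → Set X} (hf : ∀ i, MeasurableSet (f i))
    (hd : Pairwise (Disjoint on f)) (h k : H) :
    HasSum (fun i ↦ inner ℂ h (μ (f i) k)) (inner ℂ h (μ (⋃ i, f i) k)) := by
  obtain ⟨m, hm⟩ := μ.isComplexMeasure' h k
  simp only [← hm _ (hf _), ← hm _ (MeasurableSet.iUnion hf)]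
  exact m.hasSum_of_disjoint_iUnion hf hd

theorem IsNormalized.le_one [CompleteSpace H] {μ : POVM X H} (hμ : μ.IsNormalized) (hA : MeasurableSet A) :
    μ A ≤ 1 :=
  hμ ▸ μ.mono hA .univ (Set.subset_univ A)

theorem IsNormalized.compl {μ : POVM X H} (hμ : μ.IsNormalized) (hA : MeasurableSet A) :
    μ Aᶜ = 1 - μ A := by
  rw [eq_sub_iff_add_eq', ← μ.union hA hA.compl disjoint_compl_right, Set.union_compl_self]
  exact hμ

theorem IsAtom.subset {μ : POVM X H} (hA : μ.IsAtom A) (hB : MeasurableSet B) (h : B ⊆ A)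
    (h0 : μ B ≠ 0) : μ.IsAtom B := by
  refine ⟨hB, h0, fun C hC hCB ↦ ?_⟩
  rcases hA.2.2 B hB h with h1 | h1
  · exact absurd h1 h0
  · rw [h1]
    exact hA.2.2 C hC (hCB.trans h)

/-- The values of a POVM inside an atom are multiples of the value at the atom, the factor being a
scalar measure. -/
theorem IsAtom.exists_smul {μ : POVM X H} {A : Set X} (hA : μ.IsAtom A) :
    ∃ (h : H) (c : ℝ), 0 ≤ c ∧ (c : ℂ) * inner ℂ h (μ A h) = 1 ∧
      ∀ B, MeasurableSet B → ((c : ℂ) * inner ℂ h (μ (B ∩ A) h)) • μ A = μ (B ∩ A) := by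
  have hp := μ.isPositive' A hA.1
  obtain ⟨h, hh⟩ : ∃ h, inner ℂ h (μ A h) ≠ 0 := by
    by_contra! hn
    apply hA.2.1
    have : (μ A : H →ₗ[ℂ] H) = 0 := by
      refine (inner_map_self_eq_zero _).1 fun x ↦ ?_
      have := hn x
      rw [← hp.inner_left_eq_inner_right] at this
      exact this
    exact ContinuousLinearMap.coe_injective this
  have h0 := hp.inner_nonneg_right h
  obtain ⟨r, hr0, hr⟩ : ∃ r : ℝ, 0 ≤ r ∧ (r : ℂ) = inner ℂ h (μ A h) := by
    rw [Complex.le_def] at h0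
    exact ⟨_, h0.1, Complex.ext rfl h0.2⟩
  have h1 : ((r⁻¹ : ℝ) : ℂ) * inner ℂ h (μ A h) = 1 := by
    rw [← hr] at hh ⊢
    rw [Complex.ofReal_inv, inv_mul_cancel₀ hh]
  refine ⟨h, r⁻¹, inv_nonneg.2 hr0, h1, fun B hB ↦ ?_⟩
  rcases hA.2.2 _ (hB.inter hA.1) Set.inter_subset_right with h2 | h2
  · rw [h2]; simp
  · rw [h2, h1, one_smul]

end Basic

section Projection

variable {X : Type*} [MeasurableSpace X]
variable {H : Type*} [NormedAddCommGroup H] [InnerProductSpace ℂ H] [CompleteSpace H]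
variable {μ : POVM X H} {A B : Set X}

/-- Split `B` along `A`: one piece has measure below the projection `μ A`, the other below `1 - μ
A`. -/
theorem IsNormalized.mul_inter (hμ : μ.IsNormalized) (hA : MeasurableSet A)
    (hP : IsStarProjection (μ A)) (hB : MeasurableSet B) :
    μ A * μ B = μ (B ∩ A) ∧ μ B * μ A = μ (B ∩ A) := by
  have h1 := hP.mul_right_and_mul_left_of_nonneg_of_le (μ.nonneg (hB.inter hA))
    (μ.mono (hB.inter hA) hA Set.inter_subset_right)
  have h2 := hP.one_sub.mul_right_and_mul_left_of_nonneg_of_le (μ.nonneg (hB.diff hA))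
    (by rw [← hμ.compl hA]; exact μ.mono (hB.diff hA) hA.compl fun x hx ↦ hx.2)
  rw [mul_sub, mul_one, sub_eq_self, sub_mul, one_mul, sub_eq_self] at h2
  rw [← μ.inter_add_diff hB hA, mul_add, add_mul, h1.1, h1.2, h2.1, h2.2, add_zero]
  exact ⟨rfl, rfl⟩

theorem IsNormalized.mul_eq_zero (hμ : μ.IsNormalized) (hA : MeasurableSet A)
    (hP : IsStarProjection (μ A)) (hB : MeasurableSet B) (h : Disjoint A B) :
    μ A * μ B = 0 := by
  rw [(hμ.mul_inter hA hP hB).1, h.symm.inter_eq, μ.empty]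

/-- The measure of the union fixes each `μ (f i)` under left multiplication; weak countable
additivity then gives idempotence. -/
theorem IsNormalized.isStarProjection_iUnion (hμ : μ.IsNormalized) {ι : Type*} [Countable ι]
    {f : ι → Set X} (hf : ∀ i, MeasurableSet (f i)) (hd : Pairwise (Disjoint on f))
    (hP : ∀ i, IsStarProjection (μ (f i))) : IsStarProjection (μ (⋃ i, f i)) := by
  have hU := MeasurableSet.iUnion hf
  have hsa : IsSelfAdjoint (μ (⋃ i, f i)) := (μ.isPositive' _ hU).isSelfAdjoint
  refine ⟨?_, hsa⟩
  ext k
  refine ext_inner_left ℂ fun h ↦ ?_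
  rw [mul_apply_eq_comp, ← ContinuousLinearMap.adjoint_inner_left,
    ← ContinuousLinearMap.star_eq_adjoint, hsa.star_eq]
  refine (μ.hasSum_inner hf hd _ k).unique ?_
  convert μ.hasSum_inner hf hd h k using 2 with i
  rw [(μ.isPositive' _ hU).inner_left_eq_inner_right, ← mul_apply_eq_comp,
    (hP i).mul_eq_of_le_of_le_one (μ.mono (hf i) hU (Set.subset_iUnion f i)) (hμ.le_one hU)]

end Projection

end POVM

/-! ### Eigenvalues and the continuous functional calculus. -/

/-- If every point of an interval is an eigenvalue of a symmetric operator, then the space is not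
separable. -/
theorem ContinuousLinearMap.IsPositive.exists_not_eigenvalue {H : Type*} [NormedAddCommGroup H]
    [InnerProductSpace ℂ H] [TopologicalSpace.SeparableSpace H] {T : H →L[ℂ] H}
    (hT : T.IsPositive) {a b : ℝ} (hab : a < b) :
    ∃ c ∈ Set.Ioo a b, ∀ v : H, T v = (c : ℂ) • v → v = 0 := by
  by_contra! h
  choose v hv hv0 using h
  -- Eigenvectors for distinct real eigenvalues are orthogonal, so normalizing them gives an
  -- orthonormal family indexed by an uncountable interval.
  let u : Set.Ioo a b → H := fun c ↦ ((‖v c c.2‖⁻¹ : ℝ) : ℂ) • v c c.2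
  have hu : Orthonormal ℂ u := by
    refine ⟨fun c ↦ ?_, fun c d hcd ↦ ?_⟩
    · have := norm_ne_zero_iff.2 (hv0 c c.2)
      simp only [u, norm_smul, Complex.norm_real, norm_inv, norm_norm]
      exact inv_mul_cancel₀ this
    · have h1 := hT.inner_left_eq_inner_right (v c c.2) (v d d.2)
      rw [hv, hv, inner_smul_left, inner_smul_right, Complex.conj_ofReal, ← sub_eq_zero,
        ← sub_mul] at h1
      have h2 : ((c : ℝ) : ℂ) - ((d : ℝ) : ℂ) ≠ 0 := fun h ↦
        hcd (Subtype.ext (Complex.ofReal_injective (sub_eq_zero.1 h)))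
      simp only [u, inner_smul_left, inner_smul_right, (mul_eq_zero.1 h1).resolve_left h2,
        mul_zero]
  have h1 := Set.countable_coe_iff.1 hu.countable_of_separableSpace
  have h2 := h1.le_aleph0
  rw [Cardinal.mk_Ioo_real hab] at h2
  exact absurd h2 (not_le.2 Cardinal.aleph0_lt_continuum)

/-- A bump function `b` supported near `x₀` satisfies `g * b = c * b`, and `b(T) ≠ 0` because `x₀`
is in the spectrum; every vector in the range of `b(T)` is then fixed up to the factor `c`. -/
theorem exists_ne_zero_apply_cfc_eq_smul {H : Type*} [NormedAddCommGroup H]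
    [InnerProductSpace ℂ H] [CompleteSpace H] {T : H →L[ℂ] H} (hT : IsSelfAdjoint T)
    {x₀ c ε : ℝ} (hx₀ : x₀ ∈ spectrum ℝ T) (hε : 0 < ε) {g : ℝ → ℝ} (hg : Continuous g)
    (h : ∀ x, |x - x₀| < ε → g x = c) : ∃ v : H, v ≠ 0 ∧ cfc g T v = (c : ℂ) • v := by
  let b : ℝ → ℝ := fun x ↦ max 0 (ε - |x - x₀|)
  have hb : Continuous b := by fun_prop
  have hb0 : cfc b T ≠ 0 := by
    intro h0
    have h1 : b x₀ ∈ spectrum ℝ (cfc b T) := by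
      rw [cfc_map_spectrum b T]
      exact ⟨x₀, hx₀, rfl⟩
    have : Nontrivial (H →L[ℂ] H) := by
      by_contra hn
      rw [not_nontrivial_iff_subsingleton] at hn
      rw [spectrum.of_subsingleton] at hx₀
      exact hx₀
    rw [h0, spectrum.zero_eq] at h1
    simp only [b, sub_self, abs_zero, sub_zero, Set.mem_singleton_iff, max_eq_left_iff] at h1
    linarith
  have hmul : cfc g T * cfc b T = (c : ℂ) • cfc b T := by
    rw [← cfc_mul g b T, Complex.coe_smul, ← cfc_smul c b T]
    refine cfc_congr fun x _ ↦ ?_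
    by_cases hx : |x - x₀| < ε
    · simp [h x hx]
    · have : b x = 0 := max_eq_left (by linarith)
      simp [this]
  obtain ⟨y, hy⟩ : ∃ y, cfc b T y ≠ 0 := by
    by_contra! hn
    exact hb0 (ContinuousLinearMap.ext hn)
  refine ⟨cfc b T y, hy, ?_⟩
  rw [← mul_apply_eq_comp, hmul, smul_apply]

/-- The witness is the scalar `1 / √n`. It serves to write a POVM as a trivial combination of `n`
copies of itself. -/
theorem exists_isUnit_sum_star_mul_mul {H : Type*} [NormedAddCommGroup H]
    [InnerProductSpace ℂ H] [CompleteSpace H] {n : ℕ} (hn : 0 < n) :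
    ∃ C : H →L[ℂ] H, IsUnit C ∧ ∀ S : H →L[ℂ] H, ∑ _i : Fin n, star C * S * C = S := by
  have hn0 : (0 : ℝ) < n := by exact_mod_cast hn
  have hc : (√n)⁻¹ * (√n)⁻¹ * n = (1 : ℝ) := by
    rw [← mul_inv, Real.mul_self_sqrt hn0.le, inv_mul_cancel₀ hn0.ne']
  have hc0 : (((√n)⁻¹ : ℝ) : ℂ) ≠ 0 :=
    Complex.ofReal_ne_zero.2 (inv_ne_zero (Real.sqrt_ne_zero'.2 hn0))
  refine ⟨algebraMap ℂ _ (((√n)⁻¹ : ℝ) : ℂ), hc0.isUnit.map (algebraMap ℂ _), fun S ↦ ?_⟩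
  rw [Finset.sum_const, Finset.card_univ, Fintype.card_fin, ← algebraMap_star_comm, mul_assoc,
    ← Algebra.commutes, ← mul_assoc, ← map_mul, ← Algebra.smul_def, ← Nat.cast_smul_eq_nsmul ℂ,
    smul_smul, Complex.star_def, Complex.conj_ofReal, ← Complex.ofReal_natCast,
    ← Complex.ofReal_mul, ← Complex.ofReal_mul, mul_comm, hc, Complex.ofReal_one, one_smul]

/-! ### Perturbation of an extreme POVM at an atom. -/

namespace POVM

variable {X : Type*} [MeasurableSpace X]
variable {H : Type*} [NormedAddCommGroup H] [InnerProductSpace ℂ H] [CompleteSpace H]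

open Classical ComplexOrder in
/-- Outside of `A` compress `μ` by `S`, inside of `A` use a multiple of the scalar measure
`⟨h, μ(·) h⟩` times `G`. -/
noncomputable def perturb (μ : POVM X H) {A : Set X} (hA : MeasurableSet A) (h : H) {c : ℝ}
    (hc : 0 ≤ c) (S : H →L[ℂ] H) {G : H →L[ℂ] H} (hG : G.IsPositive) : POVM X H where
  toFun B := if MeasurableSet B then
    star S * μ (B \ A) * S + ((c : ℂ) * inner ℂ h (μ (B ∩ A) h)) • G else 0
  isPositive' B hB := by
    rw [if_pos hB]
    refine .add ?_ (hG.smul_of_nonneg ?_)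
    · exact (μ.isPositive' _ (hB.diff hA)).adjoint_conj S
    · exact mul_nonneg (by exact_mod_cast hc) ((μ.isPositive' _ (hB.inter hA)).inner_nonneg_right h)
  isComplexMeasure' x y := by
    obtain ⟨m, hm⟩ := μ.isComplexMeasure' (S x) (S y)
    obtain ⟨m', hm'⟩ := μ.isComplexMeasure' h h
    refine ⟨m.restrict Aᶜ + ((c : ℂ) * inner ℂ x (G y)) • m'.restrict A, fun B hB ↦ ?_⟩
    rw [if_pos hB, add_apply, smul_apply,
      MeasureTheory.VectorMeasure.restrict_apply _ hA.compl hB,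
      MeasureTheory.VectorMeasure.restrict_apply _ hA hB, hm _ (hB.inter hA.compl),
      hm' _ (hB.inter hA), add_apply, inner_add_right, mul_apply_eq_comp, mul_apply_eq_comp,
      ContinuousLinearMap.star_eq_adjoint, ContinuousLinearMap.adjoint_inner_right,
      smul_apply, inner_smul_right, Set.sdiff_eq, smul_eq_mul]
    ring
  not_measurable' B hB := if_neg hB

theorem perturb_apply (μ : POVM X H) {A : Set X} (hA : MeasurableSet A) (h : H) {c : ℝ}
    (hc : 0 ≤ c) (S : H →L[ℂ] H) {G : H →L[ℂ] H} (hG : G.IsPositive) {B : Set X}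
    (hB : MeasurableSet B) : μ.perturb hA h hc S hG B =
      star S * μ (B \ A) * S + ((c : ℂ) * inner ℂ h (μ (B ∩ A) h)) • G :=
  if_pos hB


/-- Off `A` the factors `Wᵢ(T)^(-1/2)` of the perturbed POVMs cancel the coefficients `√(Wᵢ(T) /
2)`. On `A` the contributions `(Wᵢ - (1 - x)) / 2` add up to `x` since `W₀ + W₁ = 2`. The bound `1 /
2` keeps the `Wᵢ` invertible; the bound by `x` on the spectrum makes the new values at `A` positive.
-/
theorem IsCStarExtreme.exists_unitary_cfc {μ : POVM X H} (hμ : μ.IsCStarExtreme) {A : Set X}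
    (hA : μ.IsAtom A) {w : ℝ → ℝ} (hw : Continuous w) (hw1 : ∀ x, |w x - 1| ≤ 1 / 2)
    (hw2 : ∀ x ∈ spectrum ℝ (μ A), |w x - 1| ≤ x) :
    ∃ U ∈ unitary (H →L[ℂ] H), cfc (fun x ↦ 1 - (1 - x) / w x) (μ A) = star U * μ A * U := by
  obtain ⟨h, c, hc, hA1, hA2⟩ := hA.exists_smul
  set T := μ A
  have hT : IsSelfAdjoint T := (μ.isPositive' A hA.1).isSelfAdjoint
  let W : Fin 2 → ℝ → ℝ := ![w, fun x ↦ 2 - w x]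
  have hW : ∀ i, Continuous (W i) := by
    intro i; fin_cases i
    · exact hw
    · exact continuous_const.sub hw
  have hWpos : ∀ i x, 0 < W i x := by
    intro i x
    have := abs_le.1 (hw1 x)
    fin_cases i
    · show 0 < w x; linarith
    · show 0 < 2 - w x; linarith
  have hWx : ∀ i, ∀ x ∈ spectrum ℝ T, 1 - x ≤ W i x := by
    intro i x hx
    have := abs_le.1 (hw2 x hx)
    fin_cases i
    · show 1 - x ≤ w x; linarith
    · show 1 - x ≤ 2 - w x; linarith
  have hWne : ∀ i x, W i x ≠ 0 := fun i x ↦ (hWpos i x).ne'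
  have hsne : ∀ i x, √(W i x) ≠ 0 := fun i x ↦ (Real.sqrt_pos.2 (hWpos i x)).ne'
  let s : Fin 2 → ℝ → ℝ := fun i x ↦ (√(W i x))⁻¹
  have hs : ∀ i, Continuous (s i) := fun i ↦ (hW i).sqrt.inv₀ (hsne i)
  let g : Fin 2 → ℝ → ℝ := fun i x ↦ 1 - (1 - x) / W i x
  have hg : ∀ i, Continuous (g i) := fun i ↦
    continuous_const.sub ((continuous_const.sub continuous_id).div (hW i) (hWne i))
  let t : Fin 2 → ℝ → ℝ := fun i x ↦ √(W i x) * (√2)⁻¹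
  have ht : ∀ i, Continuous (t i) := fun i ↦ (hW i).sqrt.mul continuous_const
  have h2 : (√2 : ℝ) * √2 = 2 := Real.mul_self_sqrt (by norm_num)
  have h2i : (√2 : ℝ)⁻¹ * (√2)⁻¹ = 1 / 2 := by rw [← mul_inv, h2]; norm_num
  have h2ne : (√2 : ℝ) ≠ 0 := by positivity
  have hsq : ∀ i x, √(W i x) * √(W i x) = W i x := fun i x ↦ Real.mul_self_sqrt (hWpos i x).le
  have hssa : ∀ i, star (cfc (s i) T) = cfc (s i) T := fun i ↦ (cfc_predicate (s i) T).star_eq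
  have htsa : ∀ i, star (cfc (t i) T) = cfc (t i) T := fun i ↦ (cfc_predicate (t i) T).star_eq
  have hG : ∀ i, (cfc (g i) T).IsPositive := by
    intro i
    rw [← ContinuousLinearMap.nonneg_iff_isPositive]
    refine cfc_nonneg fun x hx ↦ ?_
    have := (div_le_one (hWpos i x)).2 (hWx i x hx)
    show 0 ≤ 1 - (1 - x) / W i x
    linarith
  have hmul : ∀ f k : ℝ → ℝ, Continuous f → Continuous k →
      cfc f T * cfc k T = cfc (fun x ↦ f x * k x) T := fun f k hf hk ↦
    (cfc_mul f k T hf.continuousOn hk.continuousOn).symm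
  have hadd : ∀ f k : ℝ → ℝ, Continuous f → Continuous k →
      cfc f T + cfc k T = cfc (fun x ↦ f x + k x) T := fun f k hf hk ↦
    (cfc_add T f k hf.continuousOn hk.continuousOn).symm
  have hsub : Continuous fun x : ℝ ↦ 1 - x := continuous_const.sub continuous_id
  have hst : ∀ i, cfc (s i) T * cfc (t i) T = algebraMap ℝ (H →L[ℂ] H) (√2)⁻¹ := by
    intro i
    rw [hmul _ _ (hs i) (ht i), ← cfc_const (√2)⁻¹ T]
    refine cfc_congr fun x _ ↦ ?_
    simp only [s, t]
    rw [← mul_assoc, inv_mul_cancel₀ (hsne i x), one_mul]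
  have hts : ∀ i, cfc (t i) T * cfc (s i) T = algebraMap ℝ (H →L[ℂ] H) (√2)⁻¹ := by
    intro i
    rw [← hst i]
    exact cfc_commute_cfc _ _ T
  have hcomp : μ Aᶜ = cfc (fun x : ℝ ↦ 1 - x) T := by
    rw [hμ.1.compl hA.1, cfc_sub _ _ T, cfc_const_one ℝ T, cfc_id' ℝ T]
  let ν : Fin 2 → POVM X H := fun i ↦ μ.perturb hA.1 h hc (cfc (s i) T) (hG i)
  have hν : ∀ i B, MeasurableSet B → ν i B = star (cfc (s i) T) * μ (B \ A) * cfc (s i) T +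
      ((c : ℂ) * inner ℂ h (μ (B ∩ A) h)) • cfc (g i) T := fun i B hB ↦
    μ.perturb_apply hA.1 h hc _ (hG i) hB
  have hmain : μ.IsProperCStarCombination ν (fun i ↦ cfc (t i) T) := by
    refine ⟨fun i ↦ ?_, fun i ↦ ?_, ?_, fun B hB ↦ ?_⟩
    · show ν i Set.univ = 1
      rw [hν i _ .univ, Set.univ_inter, hA1, one_smul, hssa, ← Set.compl_eq_univ_sdiff, hcomp,
        hmul _ _ (hs i) hsub, hmul _ _ ((hs i).fun_mul hsub) (hs i),
        hadd _ _ (((hs i).fun_mul hsub).fun_mul (hs i)) (hg i), ← cfc_const_one ℝ T]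
      refine cfc_congr fun x _ ↦ ?_
      have : s i x * s i x = (W i x)⁻¹ := by simp only [s]; rw [← mul_inv, hsq]
      calc s i x * (1 - x) * s i x + g i x = s i x * s i x * (1 - x) + g i x := by ring
        _ = 1 := by rw [this]; simp only [g]; ring
    · have hcomm : algebraMap ℝ (H →L[ℂ] H) (√2) * algebraMap ℝ (H →L[ℂ] H) (√2)⁻¹ = 1 := by
        rw [← map_mul, mul_inv_cancel₀ h2ne, map_one]
      refine ⟨⟨cfc (t i) T, algebraMap ℝ (H →L[ℂ] H) (√2) * cfc (s i) T, ?_, ?_⟩, rfl⟩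
      · rw [← mul_assoc, ← Algebra.commutes, mul_assoc, hts, hcomm]
      · rw [mul_assoc, hst, hcomm]
    · simp only [htsa, Fin.sum_univ_two]
      rw [hmul _ _ (ht 0) (ht 0), hmul _ _ (ht 1) (ht 1),
        hadd _ _ ((ht 0).fun_mul (ht 0)) ((ht 1).fun_mul (ht 1)),
        ← cfc_const_one ℝ T]
      refine cfc_congr fun x _ ↦ ?_
      have : ∀ i, t i x * t i x = W i x / 2 := fun i ↦ by
        simp only [t]; rw [mul_mul_mul_comm, hsq, h2i]; ring
      simp only [this, W]
      show w x / 2 + (2 - w x) / 2 = 1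
      ring
    · have hterm : ∀ i, star (cfc (t i) T) * ν i B * cfc (t i) T = (1 / 2 : ℝ) • μ (B \ A) +
          ((c : ℂ) * inner ℂ h (μ (B ∩ A) h)) • cfc (fun x ↦ (W i x - (1 - x)) / 2) T := by
        intro i
        rw [hν i B hB, mul_add, add_mul, htsa, hssa]
        congr 1
        · calc cfc (t i) T * (cfc (s i) T * μ (B \ A) * cfc (s i) T) * cfc (t i) T
              = (cfc (t i) T * cfc (s i) T) * μ (B \ A) * (cfc (s i) T * cfc (t i) T) := by
                simp only [mul_assoc]
            _ = (1 / 2 : ℝ) • μ (B \ A) := by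
                rw [hts, hst, mul_assoc, ← Algebra.commutes, ← mul_assoc, ← map_mul, h2i,
                  Algebra.smul_def]
        · rw [mul_smul_comm, smul_mul_assoc, hmul _ _ (ht i) (hg i),
            hmul _ _ ((ht i).fun_mul (hg i)) (ht i)]
          congr 1
          refine cfc_congr fun x _ ↦ ?_
          have : t i x * t i x = W i x / 2 := by
            simp only [t]; rw [mul_mul_mul_comm, hsq, h2i]; ring
          calc t i x * g i x * t i x = t i x * t i x * g i x := by ring
            _ = (W i x - (1 - x)) / 2 := by
              rw [this]; simp only [g]; field_simp [hWne i x]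
      have hc' : ∀ i, Continuous fun x ↦ (W i x - (1 - x)) / 2 := fun i ↦
        ((hW i).sub (continuous_const.sub continuous_id)).div_const 2
      have hsum : cfc (fun x ↦ (W 0 x - (1 - x)) / 2) T + cfc (fun x ↦ (W 1 x - (1 - x)) / 2) T
          = T := by
        rw [hadd _ _ (hc' 0) (hc' 1)]
        conv_rhs => rw [← cfc_id' ℝ T]
        refine cfc_congr fun x _ ↦ ?_
        show (w x - (1 - x)) / 2 + (2 - w x - (1 - x)) / 2 = x
        ring
      rw [Fin.sum_univ_two, hterm, hterm, add_add_add_comm, ← smul_add (_ * _), hsum, hA2 B hB,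
        ← add_smul]
      norm_num
      rw [add_comm, μ.inter_add_diff hB hA.1]
  obtain ⟨U, hU, hUA⟩ := hμ.2 2 ν _ hmain 0
  refine ⟨U, hU, ?_⟩
  rw [← hUA A hA.1, hν 0 A hA.1, Set.sdiff_self, μ.empty, mul_zero, zero_mul, zero_add,
    Set.inter_self, hA1, one_smul]
  rfl

/-- Solving `1 - (1 - x) / w = c` gives `w = (1 - x) / (1 - c)`; truncating it to `[1 - m, 1 + m]`
with `m = min x (1 / 2)` for `x ≥ 0` enforces the bounds and changes nothing near `x₀`. -/
theorem exists_perturbation_weight {x₀ : ℝ} (h0 : 0 < x₀) (h1 : x₀ < 1) :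
    ∃ ε > 0, ∀ c ∈ Set.Ioo (x₀ - ε) (x₀ + ε), ∃ w : ℝ → ℝ, Continuous w ∧
      (∀ x, |w x - 1| ≤ 1 / 2) ∧ (∀ x, 0 ≤ x → |w x - 1| ≤ x) ∧
        ∀ x, |x - x₀| < ε → 1 - (1 - x) / w x = c := by
  have hpos : 0 < x₀ * (1 - x₀) := mul_pos h0 (by linarith)
  -- With this radius, `|c - x| ≤ (x₀ / 2) * ((1 - x₀) / 2) ≤ m x * (1 - c)`, so the truncation is
  -- inactive.
  refine ⟨x₀ * (1 - x₀) / 8, by positivity, fun c hc ↦ ?_⟩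
  have hε1 : x₀ * (1 - x₀) / 8 ≤ x₀ / 8 := by nlinarith
  have hε2 : x₀ * (1 - x₀) / 8 ≤ (1 - x₀) / 8 := by nlinarith
  have hc1 : 0 < 1 - c := by linarith [hc.2]
  let m : ℝ → ℝ := fun x ↦ min (max x 0) (1 / 2)
  have hm0 : ∀ x, 0 ≤ m x := fun x ↦ le_min (le_max_right _ _) (by norm_num)
  have hm1 : ∀ x, m x ≤ 1 / 2 := fun x ↦ min_le_right _ _
  let w : ℝ → ℝ := fun x ↦ max (1 - m x) (min (1 + m x) ((1 - x) / (1 - c)))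
  have hw : ∀ x, |w x - 1| ≤ m x := fun x ↦ by
    rw [abs_le]
    have h1 : 1 - m x ≤ w x := le_max_left _ _
    have h2 : w x ≤ 1 + m x := max_le (by linarith [hm0 x]) (min_le_left _ _)
    constructor <;> linarith
  refine ⟨w, ?_, fun x ↦ (hw x).trans (hm1 x), fun x hx ↦ (hw x).trans ?_, fun x hx ↦ ?_⟩
  · simp only [w, m]; fun_prop
  · simp only [m, max_eq_left hx]; exact min_le_left _ _
  · rw [abs_lt] at hx
    have hx0 : 0 < x := by linarith
    have hd : |(1 - x) / (1 - c) - 1| ≤ m x := by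
      have : (1 - x) / (1 - c) - 1 = (c - x) / (1 - c) := by field_simp; ring
      rw [this, abs_div, abs_of_pos hc1, div_le_iff₀ hc1]
      have h3 : |c - x| ≤ x₀ * (1 - x₀) / 4 := by
        rw [abs_le]; constructor <;> linarith [hc.1, hc.2]
      have h4 : x₀ / 2 ≤ m x := by
        simp only [m, max_eq_left hx0.le]
        exact le_min (by linarith) (by linarith)
      have h5 : (1 - x₀) / 2 ≤ 1 - c := by linarith [hc.2]
      calc |c - x| ≤ x₀ / 2 * ((1 - x₀) / 2) := by linarith
        _ ≤ m x * (1 - c) := mul_le_mul h4 h5 (by linarith) (hm0 x)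
    rw [abs_le] at hd
    have hwx : w x = (1 - x) / (1 - c) := by
      simp only [w]
      rw [min_eq_right (by linarith), max_eq_right (by linarith)]
    have hx1 : 1 - x ≠ 0 := by linarith
    rw [hwx, div_div_cancel₀ hx1]
    ring

/-- The value of a `C*`-extreme POVM at an atom is a projection. -/
theorem IsCStarExtreme.isStarProjection_of_isAtom [TopologicalSpace.SeparableSpace H]
    {μ : POVM X H} (hμ : μ.IsCStarExtreme) {A : Set X} (hA : μ.IsAtom A) :
    IsStarProjection (μ A) := by
  have hT : IsSelfAdjoint (μ A) := (μ.isPositive' A hA.1).isSelfAdjoint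
  refine isStarProjection_iff_spectrum_subset_and_isSelfAdjoint.2 ⟨fun x₀ hx₀ ↦ ?_, hT⟩
  have hs0 : ∀ x ∈ spectrum ℝ (μ A), 0 ≤ x := fun x hx ↦
    spectrum_nonneg_of_nonneg (μ.nonneg hA.1) hx
  have h1 : x₀ ≤ 1 := by
    refine (le_algebraMap_iff_spectrum_le (R := ℝ) (r := (1 : ℝ)) (a := μ A)).1 ?_ x₀ hx₀
    rw [map_one]
    exact hμ.1.le_one hA.1
  by_contra hn
  simp only [Set.mem_insert_iff, Set.mem_singleton_iff, not_or] at hn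
  obtain ⟨ε, hε, hc⟩ := exists_perturbation_weight
    (lt_of_le_of_ne (hs0 x₀ hx₀) (Ne.symm hn.1)) (lt_of_le_of_ne h1 hn.2)
  obtain ⟨c, hcI, hce⟩ := (μ.isPositive' A hA.1).exists_not_eigenvalue
    (a := x₀ - ε) (b := x₀ + ε) (by linarith)
  obtain ⟨w, hw, hw1, hw2, hw3⟩ := hc c hcI
  obtain ⟨U, hU, hUA⟩ := hμ.exists_unitary_cfc hA hw hw1 fun x hx ↦ hw2 x (hs0 x hx)
  have hwne : ∀ x, w x ≠ 0 := fun x h ↦ by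
    have := abs_le.1 (hw1 x)
    linarith
  obtain ⟨v, hv0, hv⟩ := exists_ne_zero_apply_cfc_eq_smul hT hx₀ hε
    (continuous_const.sub ((continuous_const.sub continuous_id).div hw hwne)) hw3
  apply hv0
  -- `U` carries the `c`-eigenvector `v` of the perturbed value to one of `μ A`, but `c` was chosen
  -- not to be an eigenvalue of `μ A`.
  have hUv : U v = 0 := by
    refine hce _ ?_
    rw [← map_smul, ← hv, ← mul_apply_eq_comp, ← mul_apply_eq_comp]
    have : U * cfc (fun x ↦ 1 - (1 - x) / w x) (μ A) = μ A * U := by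
      rw [hUA, ← mul_assoc, ← mul_assoc, Unitary.mul_star_self_of_mem hU, one_mul]
    exact DFunLike.congr_fun this.symm v
  have h3 : (star U * U) v = v := by rw [Unitary.star_mul_self_of_mem hU]; rfl
  rw [← h3, mul_apply_eq_comp, hUv, map_zero]


/-! ### The atomic part of an extreme POVM. -/

/-- Disjoint sets have projections with orthogonal ranges; a unit vector from each gives an
orthonormal family. -/
theorem IsNormalized.countable_of_pairwiseDisjoint [TopologicalSpace.SeparableSpace H]
    {μ : POVM X H} (hμ : μ.IsNormalized) {F : Set (Set X)} (hF : ∀ A ∈ F, MeasurableSet A)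
    (hP : ∀ A ∈ F, IsStarProjection (μ A)) (h0 : ∀ A ∈ F, μ A ≠ 0)
    (hd : F.PairwiseDisjoint id) : F.Countable := by
  have h : ∀ A : F, ∃ y, μ A y ≠ 0 := fun A ↦ by
    by_contra! hn
    exact h0 A A.2 (ContinuousLinearMap.ext hn)
  choose y hy using h
  let u : F → H := fun A ↦ ((‖μ A (y A)‖⁻¹ : ℝ) : ℂ) • μ A (y A)
  have hu : Orthonormal ℂ u := by
    refine ⟨fun A ↦ ?_, fun A B hAB ↦ ?_⟩
    · have := norm_ne_zero_iff.2 (hy A)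
      simp only [u, norm_smul, Complex.norm_real, norm_inv, norm_norm]
      exact inv_mul_cancel₀ this
    · have h1 : inner ℂ (μ A (y A)) (μ B (y B)) = 0 := by
        rw [(μ.isPositive' A (hF A A.2)).inner_left_eq_inner_right, ← mul_apply_eq_comp,
          hμ.mul_eq_zero (hF A A.2) (hP A A.2) (hF B B.2)
            (hd A.2 B.2 fun h ↦ hAB (Subtype.ext h))]
        exact inner_zero_right _
      simp only [u, inner_smul_left, inner_smul_right, h1, mul_zero]
  exact Set.countable_coe_iff.1 hu.countable_of_separableSpace

/-- A `C*`-extreme POVM has a largest measurable set which is exhausted by atoms. -/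
theorem IsCStarExtreme.exists_atomic_part [TopologicalSpace.SeparableSpace H] {μ : POVM X H}
    (hμ : μ.IsCStarExtreme) : ∃ E, MeasurableSet E ∧
      (∀ B, MeasurableSet B → IsStarProjection (μ (B ∩ E))) ∧
      (∀ B, MeasurableSet B → μ (B ∩ E) ≠ 0 → ∃ C ⊆ B ∩ E, μ.IsAtom C) ∧
      ∀ C ⊆ Eᶜ, ¬ μ.IsAtom C := by
  obtain ⟨F, hF⟩ := zorn_subset
    {F : Set (Set X) | (∀ A ∈ F, μ.IsAtom A) ∧ F.PairwiseDisjoint id} (by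
    intro c hc hchain
    refine ⟨⋃₀ c, ⟨?_, ?_⟩, fun s hs ↦ Set.subset_sUnion_of_mem hs⟩
    · rintro A ⟨s, hs, hA⟩
      exact (hc hs).1 A hA
    · exact (Set.pairwiseDisjoint_sUnion hchain.directedOn).2 fun s hs ↦ (hc hs).2)
  have hFa : ∀ A ∈ F, μ.IsAtom A := hF.prop.1
  have hFd : F.PairwiseDisjoint id := hF.prop.2
  have hFc : F.Countable := hμ.1.countable_of_pairwiseDisjoint (fun A hA ↦ (hFa A hA).1)
    (fun A hA ↦ hμ.isStarProjection_of_isAtom (hFa A hA)) (fun A hA ↦ (hFa A hA).2.1) hFd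
  have : Countable F := hFc.to_subtype
  have hE : ∀ B, B ∩ ⋃ A : F, (A : Set X) = ⋃ A : F, B ∩ (A : Set X) := fun B ↦
    Set.inter_iUnion B _
  have hm : ∀ B, MeasurableSet B → ∀ A : F, MeasurableSet (B ∩ (A : Set X)) := fun B hB A ↦
    hB.inter (hFa A A.2).1
  have hd : ∀ B, Pairwise (Disjoint on fun A : F ↦ B ∩ (A : Set X)) := fun B A A' hAA' ↦
    (hFd A.2 A'.2 fun h ↦ hAA' (Subtype.ext h)).mono Set.inter_subset_right Set.inter_subset_right
  refine ⟨⋃ A : F, A, MeasurableSet.iUnion fun A ↦ (hFa A A.2).1, fun B hB ↦ ?_, fun B hB h0 ↦ ?_,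
    fun C hC hCa ↦ ?_⟩
  · rw [hE]
    refine hμ.1.isStarProjection_iUnion (hm B hB) (hd B) fun A ↦ ?_
    rcases (hFa A A.2).2.2 _ (hm B hB A) Set.inter_subset_right with h | h
    · rw [h]; exact .zero _
    · rw [h]; exact hμ.isStarProjection_of_isAtom (hFa A A.2)
  · by_contra! hn
    apply h0
    rw [hE] at hn ⊢
    have hz : ∀ A : F, μ (B ∩ A) = 0 := fun A ↦ by
      by_contra hne
      exact hn _ (Set.subset_iUnion (fun A : F ↦ B ∩ (A : Set X)) A)
        ((hFa A A.2).subset (hm B hB A) Set.inter_subset_right hne)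
    ext k
    refine ext_inner_left ℂ fun h ↦ ?_
    refine (μ.hasSum_inner (hm B hB) (hd B) h k).unique ?_
    simp [hz]
  -- By maximality an atom `C` outside the union belongs to `F`, hence lies inside the union as well
  -- and is empty.
  · have hins : insert C F ⊆ F := by
      refine hF.le_of_ge ⟨?_, ?_⟩ (Set.subset_insert C F)
      · rintro A (rfl | hA)
        · exact hCa
        · exact hFa A hA
      · refine hFd.insert fun A hA _ ↦ ?_
        exact (Set.disjoint_compl_right_iff_subset.2
          (Set.subset_iUnion (fun A : F ↦ (A : Set X)) ⟨A, hA⟩)).symm.mono_left hC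
    have hCF : C ∈ F := hins (Set.mem_insert C F)
    have hCe : C = ∅ := by
      refine Set.eq_empty_of_forall_notMem fun x hx ↦ hC hx ?_
      exact Set.mem_iUnion.2 ⟨⟨C, hCF⟩, hx⟩
    exact hCa.2.1 (hCe ▸ μ.empty)

/-! ### Direct sum decompositions and existence. -/

/-- The compression of a POVM to a complete subspace. -/
noncomputable def compression (μ : POVM X H) (K : Submodule ℂ H) [CompleteSpace K] : POVM X K where
  toFun B := K.orthogonalProjectionOnto ∘L μ B ∘L K.subtypeL
  isPositive' B hB := (μ.isPositive' B hB).orthogonalProjectionOnto_comp K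
  isComplexMeasure' h k := by
    obtain ⟨m, hm⟩ := μ.isComplexMeasure' h k
    refine ⟨m, fun B hB ↦ ?_⟩
    rw [hm B hB, ← K.adjoint_subtypeL, ContinuousLinearMap.comp_apply,
      ContinuousLinearMap.adjoint_inner_right]
    rfl
  not_measurable' B hB := by
    rw [μ.not_measurable' B hB]
    simp

theorem compression_apply_of_mem (μ : POVM X H) (K : Submodule ℂ H) [CompleteSpace K] {B : Set X}
    {x : K} (h : μ B x ∈ K) : (μ.compression K B x : H) = μ B x :=
  Submodule.starProjection_eq_self_iff.2 h

namespace DirectSumDecomposition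

variable {μ : POVM X H} (d : μ.DirectSumDecomposition) {A B : Set X}

/-- Exchange the two summands. -/
def swap : μ.DirectSumDecomposition where
  K₁ := d.K₂
  K₂ := d.K₁
  orthogonal_eq := by
    rw [d.orthogonal_eq]
    exact ClosedSubmodule.toSubmodule_injective d.K₁.toSubmodule.orthogonal_orthogonal.symm
  μ₁ := d.μ₂
  μ₂ := d.μ₁
  eq_directSum A hA x y := by
    rw [add_comm, d.eq_directSum A hA, add_comm]

omit [CompleteSpace H] in
theorem apply_left (hA : MeasurableSet A) (x : d.K₁.toSubmodule) : μ A x = d.μ₁ A x := by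
  simpa using d.eq_directSum A hA x 0

theorem apply_right (hA : MeasurableSet A) (x : d.K₂.toSubmodule) : μ A x = d.μ₂ A x :=
  d.swap.apply_left hA x

theorem exists_eq_add (z : H) :
    ∃ (x : d.K₁.toSubmodule) (y : d.K₂.toSubmodule), z = (x : H) + (y : H) := by
  obtain ⟨x, hx, y, hy, h⟩ := d.K₁.toSubmodule.exists_add_mem_mem_orthogonal z
  refine ⟨⟨x, hx⟩, ⟨y, ?_⟩, h⟩
  rw [d.orthogonal_eq]
  exact hy

theorem apply_eq_apply_iff (hA : MeasurableSet A) (hB : MeasurableSet B) :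
    μ A = μ B ↔ d.μ₁ A = d.μ₁ B ∧ d.μ₂ A = d.μ₂ B := by
  refine ⟨fun h ↦ ⟨?_, ?_⟩, fun h ↦ ?_⟩
  · ext x
    rw [← d.apply_left hA, ← d.apply_left hB, h]
  · ext x
    rw [← d.apply_right hA, ← d.apply_right hB, h]
  · ext z
    obtain ⟨x, y, rfl⟩ := d.exists_eq_add z
    rw [d.eq_directSum A hA, d.eq_directSum B hB, h.1, h.2]

theorem apply_eq_zero_iff (hA : MeasurableSet A) : μ A = 0 ↔ d.μ₁ A = 0 ∧ d.μ₂ A = 0 := by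
  have := d.apply_eq_apply_iff hA .empty
  rwa [μ.empty, d.μ₁.empty, d.μ₂.empty] at this

theorem isAtom_iff_left (hA : MeasurableSet A) (h : d.μ₂ A = 0) :
    μ.IsAtom A ↔ d.μ₁.IsAtom A := by
  unfold IsAtom
  rw [Ne, d.apply_eq_zero_iff hA]
  simp only [h, and_true, ne_eq]
  refine and_congr_right fun _ ↦ and_congr_right fun _ ↦ forall_congr' fun B ↦
    forall_congr' fun hB ↦ forall_congr' fun hBA ↦ ?_
  rw [d.apply_eq_zero_iff hB, d.apply_eq_apply_iff hB hA, h, d.μ₂.null_of_subset hB hA hBA h]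
  simp

theorem isAtom_iff_right (hA : MeasurableSet A) (h : d.μ₁ A = 0) :
    μ.IsAtom A ↔ d.μ₂.IsAtom A :=
  d.swap.isAtom_iff_left hA h

omit [CompleteSpace H] in
theorem isNormalized_left (hμ : μ.IsNormalized) : d.μ₁.IsNormalized := by
  refine ContinuousLinearMap.ext fun x ↦ Subtype.ext ?_
  rw [← d.apply_left .univ, hμ]
  rfl

end DirectSumDecomposition

/-- A set whose measure is a projection splits the POVM into two summands concentrated on the set
and on its complement. -/
theorem IsNormalized.exists_directSumDecomposition {μ : POVM X H} (hμ : μ.IsNormalized)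
    {E : Set X} (hE : MeasurableSet E) (hP : IsStarProjection (μ E)) :
    ∃ d : μ.DirectSumDecomposition, (∀ A, MeasurableSet A → d.μ₁ A = d.μ₁ (A ∩ E)) ∧
      ∀ A, MeasurableSet A → d.μ₂ A = d.μ₂ (A ∩ Eᶜ) := by
  have hsymm : ∀ A, MeasurableSet A → ∀ x y, inner ℂ (μ A x) y = inner ℂ x (μ A y) := fun A hA ↦
    (μ.isPositive' A hA).inner_left_eq_inner_right
  -- The range of the projection `μ E`, described as its fixed space so that closedness is
  -- immediate.
  let K : ClosedSubmodule ℂ H :=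
    ⟨LinearMap.ker (μ E - 1 : H →L[ℂ] H).toLinearMap, (μ E - 1 : H →L[ℂ] H).isClosed_ker⟩
  have hK : ∀ x, x ∈ K.toSubmodule ↔ μ E x = x := fun x ↦
    LinearMap.mem_ker.trans sub_eq_zero
  have hcomm : ∀ A, MeasurableSet A → ∀ x, μ E (μ A x) = μ (A ∩ E) x ∧
      μ A (μ E x) = μ (A ∩ E) x := fun A hA x ↦ by
    rw [← mul_apply_eq_comp, ← mul_apply_eq_comp, (hμ.mul_inter hE hP hA).1,
      (hμ.mul_inter hE hP hA).2]
    exact ⟨rfl, rfl⟩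
  have hK1 : ∀ A, MeasurableSet A → ∀ x ∈ K.toSubmodule, μ A x ∈ K.toSubmodule := by
    intro A hA x hx
    rw [hK, (hcomm A hA x).1, ← (hcomm A hA x).2, (hK x).1 hx]
  have hK2 : ∀ A, MeasurableSet A → ∀ y ∈ K.toSubmoduleᗮ, μ A y ∈ K.toSubmoduleᗮ := by
    intro A hA y hy u hu
    rw [← hsymm A hA]
    exact hy _ (hK1 A hA u hu)
  have hPy : ∀ y ∈ K.toSubmoduleᗮ, μ E y = 0 := by
    intro y hy
    have h1 : μ E (μ E y) = μ E y := by rw [(hcomm E hE y).1, Set.inter_self]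
    have h2 := hy (μ E y) ((hK _).2 h1)
    rwa [hsymm E hE, ← h1, ← hsymm E hE, inner_self_eq_zero] at h2
  let d : μ.DirectSumDecomposition :=
    { K₁ := K
      K₂ := Kᗮ
      orthogonal_eq := rfl
      μ₁ := μ.compression K.toSubmodule
      μ₂ := μ.compression Kᗮ.toSubmodule
      eq_directSum := fun A hA x y ↦ by
        rw [μ.compression_apply_of_mem K.toSubmodule (hK1 A hA x x.2),
          μ.compression_apply_of_mem Kᗮ.toSubmodule (hK2 A hA y y.2), map_add] }
  refine ⟨d, fun A hA ↦ ?_, fun A hA ↦ ?_⟩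
  · refine ContinuousLinearMap.ext fun x ↦ Subtype.ext ?_
    rw [← d.apply_left hA, ← d.apply_left (hA.inter hE), ← (hcomm A hA x).2, (hK x).1 x.2]
  · refine ContinuousLinearMap.ext fun y ↦ Subtype.ext ?_
    rw [← d.apply_right hA, ← d.apply_right (hA.inter hE.compl), ← μ.inter_add_diff hA hE,
      add_apply, ← (hcomm A hA y).2, hPy y y.2, map_zero, zero_add, Set.sdiff_eq]

theorem IsCStarExtreme.exists_isAtomicNonAtomic [TopologicalSpace.SeparableSpace H]
    {μ : POVM X H} (hμ : μ.IsCStarExtreme) :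
    ∃ d : μ.DirectSumDecomposition, d.IsAtomicNonAtomic ∧ d.μ₁.IsSpectral := by
  obtain ⟨E, hE, hP, hat, hna⟩ := hμ.exists_atomic_part
  have hPE : IsStarProjection (μ E) := Set.inter_self E ▸ hP E hE
  obtain ⟨d, h1, h2⟩ := hμ.1.exists_directSumDecomposition hE hPE
  have hn1 := d.isNormalized_left hμ.1
  have hn2 : d.μ₂.IsNormalized := d.swap.isNormalized_left hμ.1
  have hz1 : ∀ A, MeasurableSet A → d.μ₁ (A ∩ Eᶜ) = 0 := fun A hA ↦ by
    rw [h1 _ (hA.inter hE.compl), Set.inter_assoc, Set.compl_inter_self, Set.inter_empty,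
      d.μ₁.empty]
  have hz2 : ∀ A, MeasurableSet A → A ⊆ E → d.μ₂ A = 0 := fun A hA hAE ↦ by
    rw [h2 _ hA, (Set.disjoint_compl_right_iff_subset.2 hAE).inter_eq, d.μ₂.empty]
  refine ⟨d, ⟨hn1, fun A hA h0 ↦ ?_, hn2, fun A hA ↦ ?_,
    E, Eᶜ, hE, hE.compl, disjoint_compl_right, h1, h2⟩, hn1, fun A hA ↦ ⟨?_, ?_⟩⟩
  · have h3 : μ (A ∩ E) ≠ 0 := fun h ↦ by
      rw [d.apply_eq_zero_iff (hA.inter hE), ← h1 A hA] at h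
      exact h0 h.1
    obtain ⟨C, hC, hCa⟩ := hat A hA h3
    exact ⟨C, hC.trans Set.inter_subset_left, (d.isAtom_iff_left hCa.1
      (hz2 C hCa.1 (hC.trans Set.inter_subset_right))).1 hCa⟩
  · have hA' := hA.1.inter hE.compl
    refine hna _ Set.inter_subset_right ((d.isAtom_iff_right hA' (hz1 A hA.1)).2
      (hA.subset hA' Set.inter_subset_left ?_))
    rw [← h2 A hA.1]
    exact hA.2.1
  · refine ContinuousLinearMap.ext fun x ↦ Subtype.ext ?_
    rw [h1 A hA, mul_apply_eq_comp, ← d.apply_left (hA.inter hE), ← d.apply_left (hA.inter hE),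
      ← mul_apply_eq_comp, (hP A hA).isIdempotentElem.eq]
  · exact (d.μ₁.isPositive' A hA).isSelfAdjoint


/-! ### Uniqueness of the decomposition. -/

namespace DirectSumDecomposition

variable {μ : POVM X H} (d : μ.DirectSumDecomposition) {A B : Set X}

theorem ext_of_left {d d' : μ.DirectSumDecomposition} (h : d.K₁ = d'.K₁) : d = d' := by
  have h1 := fun A hA ↦ d.apply_left (A := A) hA
  have h2 := fun A hA ↦ d.apply_right (A := A) hA
  have h1' := fun A hA ↦ d'.apply_left (A := A) hA
  have h2' := fun A hA ↦ d'.apply_right (A := A) hA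
  obtain ⟨K₁, K₂, hK, μ₁, μ₂, hd⟩ := d
  obtain ⟨K₁', K₂', hK', μ₁', μ₂', hd'⟩ := d'
  dsimp only at h h1 h2 h1' h2'
  subst h hK hK'
  have e1 : μ₁ = μ₁' := by
    refine POVM.ext (funext fun A ↦ ?_)
    by_cases hA : MeasurableSet A
    · ext x
      rw [← h1 A hA, ← h1' A hA]
    · rw [μ₁.not_measurable' A hA, μ₁'.not_measurable' A hA]
  have e2 : μ₂ = μ₂' := by
    refine POVM.ext (funext fun A ↦ ?_)
    by_cases hA : MeasurableSet A
    · ext x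
      rw [← h2 A hA, ← h2' A hA]
    · rw [μ₂.not_measurable' A hA, μ₂'.not_measurable' A hA]
  subst e1 e2
  rfl

theorem mem_left_iff (hA : MeasurableSet A) (h1 : d.μ₁ A = 1) (h2 : d.μ₂ A = 0) (x : H) :
    x ∈ d.K₁ ↔ μ A x = x := by
  refine ⟨fun hx ↦ ?_, fun hx ↦ ?_⟩
  · have := d.apply_left hA ⟨x, hx⟩
    rwa [h1] at this
  · obtain ⟨y, z, rfl⟩ := d.exists_eq_add x
    rw [d.eq_directSum A hA, h1, h2] at hx
    rw [← hx]
    simp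

/-- If `E \ E'` were not null, it would contain an atom of `d.μ₁`. Inside `E` this is an atom of
`μ`, and outside `E'` it is then an atom of the non-atomic `d'.μ₂`. -/
theorem null_diff {d d' : μ.DirectSumDecomposition} (hd : d.μ₁.IsAtomic)
    (hd' : d'.μ₂.IsNonAtomic) {E E' : Set X} (hE : MeasurableSet E) (hE' : MeasurableSet E')
    (h2 : d.μ₂ E = 0) (h1' : d'.μ₁ E'ᶜ = 0) : μ (E \ E') = 0 := by
  have hm := hE.diff hE'
  rw [d.apply_eq_zero_iff hm]
  refine ⟨?_, d.μ₂.null_of_subset hm hE Set.sdiff_subset h2⟩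
  by_contra h0
  obtain ⟨C, hC, hCa⟩ := hd _ hm h0
  have hCμ := (d.isAtom_iff_left hCa.1
    (d.μ₂.null_of_subset hCa.1 hE (hC.trans Set.sdiff_subset) h2)).2 hCa
  exact hd' C ((d'.isAtom_iff_right hCa.1
    (d'.μ₁.null_of_subset hCa.1 hE'.compl (fun x hx ↦ (hC hx).2) h1')).1 hCμ)

omit [CompleteSpace H] in
theorem exists_separating_set (h : MutuallySingular d.μ₁ d.μ₂) :
    ∃ E, MeasurableSet E ∧ d.μ₁ Eᶜ = 0 ∧ d.μ₂ E = 0 := by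
  obtain ⟨E, F, hE, hF, hd, h1, h2⟩ := h
  refine ⟨E, hE, ?_, ?_⟩
  · rw [h1 _ hE.compl, Set.compl_inter_self, d.μ₁.empty]
  · rw [h2 _ hE, hd.inter_eq, d.μ₂.empty]

/-- The separating sets of both decompositions have the same measure, and its fixed space is the
first summand in each case. -/
theorem IsAtomicNonAtomic.eq {d d' : μ.DirectSumDecomposition} (hd : d.IsAtomicNonAtomic)
    (hd' : d'.IsAtomicNonAtomic) : d = d' := by
  obtain ⟨E, hE, h1, h2⟩ := d.exists_separating_set hd.2.2.2.2
  obtain ⟨E', hE', h1', h2'⟩ := d'.exists_separating_set hd'.2.2.2.2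
  have hμ : μ E = μ E' := by
    rw [← μ.inter_add_diff hE hE', ← μ.inter_add_diff hE' hE,
      null_diff hd.2.1 hd'.2.2.2.1 hE hE' h2 h1', null_diff hd'.2.1 hd.2.2.2.1 hE' hE h2' h1,
      Set.inter_comm]
  have hone : d.μ₁ E = 1 := by
    have := hd.1.compl hE
    rw [h1] at this
    exact (sub_eq_zero.1 this.symm).symm
  have hone' : d'.μ₁ E' = 1 := by
    have := hd'.1.compl hE'
    rw [h1'] at this
    exact (sub_eq_zero.1 this.symm).symm
  refine ext_of_left (SetLike.ext fun x ↦ ?_)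
  rw [d.mem_left_iff hE hone h2, d'.mem_left_iff hE' hone' h2', hμ]

/-! ### Block-diagonal operators and extremality of the summands. -/

omit [CompleteSpace H] in
theorem mem_orthogonal_left (y : d.K₂.toSubmodule) : (y : H) ∈ d.K₁.toSubmoduleᗮ :=
  (SetLike.ext_iff.1 d.orthogonal_eq _).1 y.2

/-- The diagonal operator with respect to the decomposition of the space. -/
noncomputable def diag (S : d.K₁.toSubmodule →L[ℂ] d.K₁.toSubmodule)
    (R : d.K₂.toSubmodule →L[ℂ] d.K₂.toSubmodule) : H →L[ℂ] H :=
  d.K₁.toSubmodule.subtypeL ∘L S ∘L d.K₁.toSubmodule.orthogonalProjectionOnto +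
    d.K₂.toSubmodule.subtypeL ∘L R ∘L d.K₂.toSubmodule.orthogonalProjectionOnto

theorem diag_apply (S : d.K₁.toSubmodule →L[ℂ] d.K₁.toSubmodule)
    (R : d.K₂.toSubmodule →L[ℂ] d.K₂.toSubmodule) (x : d.K₁.toSubmodule) (y : d.K₂.toSubmodule) :
    d.diag S R ((x : H) + (y : H)) = (S x : H) + (R y : H) := by
  have hy : (y : H) ∈ d.K₁.toSubmoduleᗮ := d.mem_orthogonal_left y
  have hx : (x : H) ∈ d.K₂.toSubmoduleᗮ := d.swap.mem_orthogonal_left x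
  simp only [diag, add_apply, ContinuousLinearMap.comp_apply, map_add,
    Submodule.orthogonalProjectionOnto_mem_subspace_eq_self,
    Submodule.orthogonalProjectionOnto_apply_of_mem_orthogonal hx,
    Submodule.orthogonalProjectionOnto_apply_of_mem_orthogonal hy, map_zero, add_zero, zero_add,
    Submodule.subtypeL_apply]

theorem diag_star (S : d.K₁.toSubmodule →L[ℂ] d.K₁.toSubmodule)
    (R : d.K₂.toSubmodule →L[ℂ] d.K₂.toSubmodule) :
    star (d.diag S R) = d.diag (star S) (star R) := by
  simp only [diag, star_add, ContinuousLinearMap.star_eq_adjoint,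
    ContinuousLinearMap.adjoint_comp, Submodule.adjoint_subtypeL,
    Submodule.adjoint_orthogonalProjectionOnto, ContinuousLinearMap.comp_assoc]

/-- Diagonal operators as a ring homomorphism. -/
noncomputable def diagHom : (d.K₁.toSubmodule →L[ℂ] d.K₁.toSubmodule) ×
    (d.K₂.toSubmodule →L[ℂ] d.K₂.toSubmodule) →+* (H →L[ℂ] H) where
  toFun p := d.diag p.1 p.2
  map_one' := by
    ext z
    obtain ⟨x, y, rfl⟩ := d.exists_eq_add z
    rw [diag_apply]
    rfl
  map_zero' := by simp [diag]
  map_mul' p q := by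
    ext z
    obtain ⟨x, y, rfl⟩ := d.exists_eq_add z
    rw [mul_apply_eq_comp, diag_apply, diag_apply, diag_apply]
    rfl
  map_add' p q := by
    ext z
    obtain ⟨x, y, rfl⟩ := d.exists_eq_add z
    rw [add_apply, diag_apply, diag_apply, diag_apply, add_add_add_comm]
    rfl

theorem diagHom_apply (p) : d.diagHom p = d.diag p.1 p.2 := rfl

theorem apply_eq_diag (hA : MeasurableSet A) : μ A = d.diag (d.μ₁ A) (d.μ₂ A) := by
  ext z
  obtain ⟨x, y, rfl⟩ := d.exists_eq_add z
  rw [d.eq_directSum A hA, diag_apply]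

/-- The direct sum of two POVMs on the summands. -/
noncomputable def directSum (ν₁ : POVM X d.K₁.toSubmodule) (ν₂ : POVM X d.K₂.toSubmodule) :
    POVM X H where
  toFun A := d.diag (ν₁ A) (ν₂ A)
  isPositive' A hA := by
    refine .add ?_ ?_
    · have := (ν₁.isPositive' A hA).conj_adjoint d.K₁.toSubmodule.subtypeL
      rwa [Submodule.adjoint_subtypeL] at this
    · have := (ν₂.isPositive' A hA).conj_adjoint d.K₂.toSubmodule.subtypeL
      rwa [Submodule.adjoint_subtypeL] at this
  isComplexMeasure' h k := by
    obtain ⟨x, y, rfl⟩ := d.exists_eq_add h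
    obtain ⟨x', y', rfl⟩ := d.exists_eq_add k
    obtain ⟨m, hm⟩ := ν₁.isComplexMeasure' x x'
    obtain ⟨m', hm'⟩ := ν₂.isComplexMeasure' y y'
    have horth : ∀ (u : d.K₁.toSubmodule) (v : d.K₂.toSubmodule),
        inner ℂ (u : H) (v : H) = 0 := fun u v ↦ d.mem_orthogonal_left v u u.2
    have horth' : ∀ (u : d.K₁.toSubmodule) (v : d.K₂.toSubmodule),
        inner ℂ (v : H) (u : H) = 0 := fun u v ↦ inner_eq_zero_symm.1 (horth u v)
    refine ⟨m + m', fun A hA ↦ ?_⟩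
    rw [add_apply, hm A hA, hm' A hA, diag_apply, inner_add_left, inner_add_right, inner_add_right,
      horth, horth', add_zero, zero_add]
    rfl
  not_measurable' A hA := by
    rw [ν₁.not_measurable' A hA, ν₂.not_measurable' A hA]
    simp [diag]

theorem directSum_apply (ν₁ : POVM X d.K₁.toSubmodule) (ν₂ : POVM X d.K₂.toSubmodule) :
    d.directSum ν₁ ν₂ A = d.diag (ν₁ A) (ν₂ A) := rfl

/-- The compression of an operator to the first summand. -/
noncomputable def corner (R : H →L[ℂ] H) : d.K₁.toSubmodule →L[ℂ] d.K₁.toSubmodule :=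
  d.K₁.toSubmodule.orthogonalProjectionOnto ∘L R ∘L d.K₁.toSubmodule.subtypeL

theorem star_corner (R : H →L[ℂ] H) : star (d.corner R) = d.corner (star R) := by
  simp only [corner, ContinuousLinearMap.star_eq_adjoint,
    ContinuousLinearMap.adjoint_comp, Submodule.adjoint_subtypeL,
    Submodule.adjoint_orthogonalProjectionOnto, ContinuousLinearMap.comp_assoc]

/-- `d.diag 1 0` is the projection onto the first summand; commuting with it makes that summand
invariant under `R`. -/
theorem corner_apply {R : H →L[ℂ] H} (h : Commute R (d.diag 1 0)) (x : d.K₁.toSubmodule) :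
    (d.corner R x : H) = R x := by
  have hP : d.diag 1 0 (x : H) = x := by simpa using d.diag_apply 1 0 x 0
  refine Submodule.starProjection_eq_self_iff.2 ?_
  obtain ⟨y, z, hyz⟩ := d.exists_eq_add (R x)
  have h1 : R x = d.diag 1 0 (R x) := by
    rw [← mul_apply_eq_comp, ← h.eq, mul_apply_eq_comp, hP]
  show R x ∈ d.K₁.toSubmodule
  rw [h1, hyz, diag_apply]
  simp

/-- Padding each `ν j` with `d.μ₂` and each coefficient with a scalar gives a combination for `μ`.
The resulting unitary need not be block diagonal a priori; comparing values at `E` forces this, and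
its corner is the required unitary. -/
theorem isCStarExtreme_left (hμ : μ.IsCStarExtreme) {E : Set X} (hE : MeasurableSet E)
    (h1 : d.μ₁ Eᶜ = 0) (h2 : d.μ₂ E = 0) : d.μ₁.IsCStarExtreme := by
  have hn := d.isNormalized_left hμ.1
  have hn2 : d.μ₂.IsNormalized := d.swap.isNormalized_left hμ.1
  refine ⟨hn, fun n ν T ⟨hν, hT, hT1, hsum⟩ i ↦ ?_⟩
  -- The index `i` witnesses `0 < n`.
  obtain ⟨C, hC, hCC⟩ := exists_isUnit_sum_star_mul_mul (H := d.K₂.toSubmodule) i.pos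
  have hcomb : μ.IsProperCStarCombination (fun j ↦ d.directSum (ν j) d.μ₂)
      (fun j ↦ d.diag (T j) C) := by
    have hterm : ∀ (S : Fin n → d.K₁.toSubmodule →L[ℂ] d.K₁.toSubmodule)
        (R : d.K₂.toSubmodule →L[ℂ] d.K₂.toSubmodule),
        ∑ j, star (d.diag (T j) C) * d.diag (S j) R * d.diag (T j) C =
          d.diag (∑ j, star (T j) * S j * T j) R := by
      intro S R
      have h3 : ∀ j, star (d.diag (T j) C) * d.diag (S j) R * d.diag (T j) C =
          d.diagHom (star (T j) * S j * T j, star C * R * C) := fun j ↦ by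
        rw [diag_star, ← d.diagHom_apply (_, _), ← d.diagHom_apply (_, _),
          ← d.diagHom_apply (_, _), ← map_mul, ← map_mul]
        rfl
      simp only [h3]
      rw [← map_sum, diagHom_apply, Prod.fst_sum, Prod.snd_sum, hCC]
    refine ⟨fun j ↦ ?_, fun j ↦ ?_, ?_, fun A hA ↦ ?_⟩
    · show d.diag (ν j Set.univ) (d.μ₂ Set.univ) = 1
      rw [hν j, hn2]
      exact d.diagHom.map_one
    · exact (Prod.isUnit_iff (x := (T j, C)).2 ⟨hT j, hC⟩).map d.diagHom
    · have h3 := hterm (fun _ ↦ 1) 1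
      have h4 : d.diag 1 1 = 1 := d.diagHom.map_one
      simp only [mul_one, h4] at h3
      rw [h3, hT1, h4]
    · simp only [directSum_apply]
      rw [hterm, d.apply_eq_diag hA, hsum A hA]
  obtain ⟨U, hU, hUA⟩ := hμ.2 n _ _ hcomb i
  have hone : d.μ₁ E = 1 := by
    have := hn.compl hE
    rw [h1] at this
    exact (sub_eq_zero.1 this.symm).symm
  -- A vanishing sum of positive terms has vanishing terms, and the invertible `T i` can be
  -- cancelled.
  have hνE : ν i Eᶜ = 0 := by
    have h3 := hsum Eᶜ hE.compl
    rw [h1, eq_comm, Finset.sum_eq_zero_iff_of_nonneg fun j _ ↦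
      star_left_conjugate_nonneg ((ν j).nonneg hE.compl) _] at h3
    have h4 := h3 i (Finset.mem_univ i)
    rwa [(hT i).mul_left_eq_zero, (hT i).star.mul_right_eq_zero] at h4
  have hνone : ν i E = 1 := by
    have := (hν i).compl hE
    rw [hνE] at this
    exact (sub_eq_zero.1 this.symm).symm
  -- Both `μ` and the padded POVM take the value `d.diag 1 0` at `E`.
  have hcomm : Commute U (d.diag 1 0) := by
    have h3 := hUA E hE
    rw [directSum_apply, hνone, h2, d.apply_eq_diag hE, hone, h2] at h3
    show U * d.diag 1 0 = d.diag 1 0 * U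
    conv_lhs => rw [h3, ← mul_assoc, ← mul_assoc, Unitary.mul_star_self_of_mem hU, one_mul]
  have hcomm' : Commute (star U) (d.diag 1 0) := by
    have h3 : star (d.diag 1 0) = d.diag 1 0 := (d.diag_star 1 0).trans
      (congrArg₂ d.diag (star_one (d.K₁.toSubmodule →L[ℂ] d.K₁.toSubmodule))
        (star_zero (d.K₂.toSubmodule →L[ℂ] d.K₂.toSubmodule)))
    simpa only [h3] using hcomm.star_star
  refine ⟨d.corner U, ⟨?_, ?_⟩, fun A hA ↦ ?_⟩
  · refine ContinuousLinearMap.ext fun x ↦ Subtype.ext ?_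
    rw [star_corner, mul_apply_eq_comp, d.corner_apply hcomm', d.corner_apply hcomm,
      ← mul_apply_eq_comp, Unitary.star_mul_self_of_mem hU]
    rfl
  · refine ContinuousLinearMap.ext fun x ↦ Subtype.ext ?_
    rw [star_corner, mul_apply_eq_comp, d.corner_apply hcomm, d.corner_apply hcomm',
      ← mul_apply_eq_comp, Unitary.mul_star_self_of_mem hU]
    rfl
  · refine ContinuousLinearMap.ext fun x ↦ Subtype.ext ?_
    have h3 := DFunLike.congr_fun (hUA A hA) (x : H)
    have h4 : d.directSum (ν i) d.μ₂ A (x : H) = ν i A x := by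
      rw [directSum_apply]
      simpa using d.diag_apply (ν i A) (d.μ₂ A) x 0
    rw [h4] at h3
    rw [h3, star_corner, mul_apply_eq_comp, mul_apply_eq_comp, mul_apply_eq_comp,
      mul_apply_eq_comp, d.corner_apply hcomm', ← d.apply_left hA, d.corner_apply hcomm]

end DirectSumDecomposition

end POVM

theorem mainTheorem6 {X : Type*} [MeasurableSpace X]
    {H : Type*} [NormedAddCommGroup H] [InnerProductSpace ℂ H] [CompleteSpace H]
    [TopologicalSpace.SeparableSpace H]
    (μ : POVM X H) (hμ : μ.IsCStarExtreme) :
    (∃! d : μ.DirectSumDecomposition, d.IsAtomicNonAtomic) ∧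
      ∀ d : μ.DirectSumDecomposition, d.IsAtomicNonAtomic →
        d.μ₁.IsCStarExtreme ∧ d.μ₂.IsCStarExtreme ∧ d.μ₁.IsSpectral := by
  obtain ⟨d₀, hd₀, hs⟩ := hμ.exists_isAtomicNonAtomic
  refine ⟨⟨d₀, hd₀, fun d hd ↦ hd.eq hd₀⟩, fun d hd ↦ ?_⟩
  obtain ⟨E, hE, h1, h2⟩ := d.exists_separating_set hd.2.2.2.2
  refine ⟨d.isCStarExtreme_left hμ hE h1 h2, d.swap.isCStarExtreme_left hμ hE.compl ?_ h1, ?_⟩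
  · rw [compl_compl]
    exact h2
  · rw [hd.eq hd₀]
    exact hs
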